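/- Let $N_t,N_m,N_e$ be numbers of antennas with $N_e<N_t$, and put $n=N_t-N_e$, $m=\min(n,N_m)$, $k=\max(n,N_m)$. Let $\mathbf H_m\in\mathbb C^{N_m\times N_t}$ (main channel) and $\mathbf H_e\in\mathbb C^{N_e\times N_t}$ (eavesdropper channel) be random matrices all of whose entries are independent, circularly symmetric complex Gaussian with zero mean and unit variance. Let $A\in\mathbb C^{N_t\times n}$ be a zero-forcing precoder, i.e. almost surely $AA^\dagger$ is the orthogonal projection onto the null space of $\mathbf H_e$. For an SNR $\eta>0$, an array gain $g\ge 0$ and a secrecy multiplexing gain $r_s$, the zero-forcing secrecy outage probability is $$P_{out}^{ZF}=P\Bigl[\log\det\bigl(I+\tfrac{\eta}{n}\,\mathbf H_{eq}\mathbf H_{eq}^\dagger\bigr)<R_s\Bigr],\qquad \mathbf H_{eq}=\mathbf H_mA,\qquad R_s=r_s\log(1+g\eta).$$ Let $\Gamma_{inc}(x,a)=\frac1{(a-1)!}\int_0^x t^{a-1}e^{-t}\,dt$ and $\xi(x)=\frac{n}{\eta}\bigl((1+g\eta)^x-1\bigr)$. Then for all real coefficients $b_1\ge b_2\ge\dots\ge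 b_m\ge 0$ with $\sum_{l=1}^m b_l=r_s$, $$P_{out}^{ZF}\le\prod_{l=1}^m\Gamma_{inc}(\xi(r_s),k-l+1)\Bigl(1-\prod_{l=1}^m\Bigl[1-\frac{\Gamma_{inc}(\xi(b_l),k-l+1)}{\Gamma_{inc}(\xi(r_s),k-l+1)}\Bigr]\Bigr).$$ (If $g=0$ or $r_s=0$, then $\xi(r_s)=0$ and the right-hand side is read as $0$.) -/

import Mathlib

open MeasureTheory ProbabilityTheory
open scoped Matrix

noncomputable section

/-- The standard circularly symmetric complex Gaussian law `𝒞𝒩(0, 1)`: real and imaginary parts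
are independent, centred Gaussian of variance `1/2`, so that the total variance is `1`. -/
def complexGaussian : Measure ℂ :=
  ((gaussianReal 0 (1 / 2)).prod (gaussianReal 0 (1 / 2))).map
    Complex.measurableEquivRealProd.symm

/-- Quasi-static fading: the entries of the main channel matrix `Hm` and of the eavesdropper
channel matrix `He` form one family of independent `𝒞𝒩(0, 1)` random variables. -/
structure IsIIDGaussianChannel {Ω : Type*} [MeasurableSpace Ω] (μ : Measure Ω) {Nt Nm Ne : ℕ}
    (Hm : Ω → Matrix (Fin Nm) (Fin Nt) ℂ) (He : Ω → Matrix (Fin Ne) (Fin Nt) ℂ) : Prop where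
  law_main : ∀ i j, HasLaw (fun ω => Hm ω i j) complexGaussian μ
  law_eve : ∀ i j, HasLaw (fun ω => He ω i j) complexGaussian μ
  indep : iIndepFun
    (Sum.elim (fun (p : Fin Nm × Fin Nt) (ω : Ω) => Hm ω p.1 p.2)
      (fun (p : Fin Ne × Fin Nt) (ω : Ω) => He ω p.1 p.2)) μ

/-- `A` is a zero-forcing precoder for the eavesdropper channel `H`: `A Aᴴ` is the matrix of the
orthogonal projection of `ℂ^Nt` onto the null space of `H`. -/
def IsZFPrecoder {Nt Ne : ℕ} (H : Matrix (Fin Ne) (Fin Nt) ℂ)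
    (A : Matrix (Fin Nt) (Fin (Nt - Ne)) ℂ) : Prop :=
  Matrix.toEuclideanCLM (𝕜 := ℂ) (A * Aᴴ) =
    (LinearMap.ker (Matrix.toEuclideanLin H)).starProjection

/-- The mutual information `log det (I + c H Hᴴ)`, in nats per channel use, of the channel `H`
with Gaussian input of covariance `c I`. -/
def mutualInfo (c : ℝ) {p q : ℕ} (H : Matrix (Fin p) (Fin q) ℂ) : ℝ :=
  Real.log (Matrix.det (1 + (c : ℂ) • (H * Hᴴ))).re

/-- The zero-forcing secrecy outage probability at SNR `η` and secrecy rate `Rs`: the probability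
that the mutual information of the equivalent channel `Hm A`, with input covariance
`η / (Nt - Ne) I`, is smaller than `Rs`. -/
def zfOutageProb {Ω : Type*} [MeasurableSpace Ω] (μ : Measure Ω) {Nt Nm : ℕ} (Ne : ℕ)
    (Hm : Ω → Matrix (Fin Nm) (Fin Nt) ℂ) (A : Ω → Matrix (Fin Nt) (Fin (Nt - Ne)) ℂ)
    (η Rs : ℝ) : ℝ :=
  μ.real {ω | mutualInfo (η / ((Nt : ℝ) - (Ne : ℝ))) (Hm ω * A ω) < Rs}

/-- The secrecy rate with secrecy multiplexing gain `rs` at SNR `η` and array gain `g`. -/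
def secrecyRate (g η rs : ℝ) : ℝ := rs * Real.log (1 + g * η)

/-- The regularized lower incomplete Gamma function `Γ_inc(x, a)` for a positive integer `a`. -/
def gammaInc (x : ℝ) (a : ℕ) : ℝ :=
  1 / ((a - 1).factorial : ℝ) * ∫ t in (0 : ℝ)..x, t ^ (a - 1) * Real.exp (-t)

/-- `ξ(x) = (Nt - Ne) / η * ((1 + g η) ^ x - 1)`. -/
def zfXi (Nt Ne : ℕ) (η g x : ℝ) : ℝ :=
  ((Nt : ℝ) - (Ne : ℝ)) / η * ((1 + g * η) ^ x - 1)

end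

/-! Write `c = η / n`. The mutual information depends on `A` only through `A Aᴴ`, the projection
onto the null space of `He`. For fixed `He` that space contains `n` orthonormal vectors, the columns
of some `U`. The projection dominates `U Uᴴ`, so replacing it by `U Uᴴ` lowers the determinant, and
`Hm U` is again iid Gaussian by unitary invariance. Outage is thus at most as likely as for an iid
Gaussian channel, which may be transposed to size `m × k`.

Rows are then peeled off one by one. If `g` is the first row, `X` the others, and `U` has `k - 1`
orthonormal columns orthogonal to `g`, the determinant is at least `1 + c ‖g‖²` times that of `X U`,
which is Gaussian of size `(m - 1) × (k - 1)` whatever `g` is. Heuristically, the determinant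
dominates `∏ (1 + c ρ_l)` with independent Gamma variables `ρ_l` of shapes `k, k - 1, …`.

By the choice of `ξ`, the outage threshold equals both `1 + c ξ(r_s)` and `∏ (1 + c ξ(b_l))`. Outage
therefore forces every `ρ_l < ξ(r_s)` and some `ρ_l < ξ(b_l)`; the probability of this is the
right-hand side. The recursion is `gaussianMat_channelDet_lt_succ_le`, the bound
`gaussianMat_channelDet_lt_le`, and the reduction `zfOutageProb_le_gaussianMat`. -/

/-! ### Determinant inequalities and the zero-forcing projection -/

section MatrixPart

open scoped ComplexOrder MatrixOrder

variable {p q r : Type*}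

theorem one_le_det_one_add_of_posSemidef [Fintype p] [DecidableEq p]
    {P : Matrix p p ℂ} (hP : P.PosSemidef) :
    1 ≤ (1 + P).det := by
  have hs := hP.1.spectral_theorem
  have h1 : (1 + P).det = ∏ i, (1 + (hP.1.eigenvalues i : ℂ)) := by
    have h2 : 1 + P = Unitary.conjStarAlgAut ℂ _ hP.1.eigenvectorUnitary
        (Matrix.diagonal fun i => 1 + (hP.1.eigenvalues i : ℂ)) := by
      conv_lhs => rw [hs]
      rw [← map_one (Unitary.conjStarAlgAut ℂ _ hP.1.eigenvectorUnitary), ← map_add]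
      congr 1
      rw [← Matrix.diagonal_one, Matrix.diagonal_add]
      rfl
    rw [h2, Unitary.conjStarAlgAut_apply, Matrix.det_mul_comm, ← mul_assoc]
    simp
  rw [h1]
  have h3 : ∀ i, 1 ≤ 1 + hP.1.eigenvalues i := fun i => by
    linarith [hP.eigenvalues_nonneg i]
  have : (1 : ℝ) ≤ ∏ i, (1 + hP.1.eigenvalues i) := by
    exact Finset.one_le_prod (f := fun i => 1 + hP.1.eigenvalues i) fun i _ => h3 i
  exact_mod_cast this

/-- With `M = Bᴴ B`, factoring out `A` and applying Sylvester's identity leaves `det (1 + B A⁻¹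
Bᴴ)`, which is at least `1`. -/
theorem det_le_det_add_of_posDef [Fintype p] [DecidableEq p]
    {A M : Matrix p p ℂ} (hA : A.PosDef) (hM : M.PosSemidef) :
    A.det ≤ (A + M).det := by
  obtain ⟨B, rfl⟩ := CStarAlgebra.nonneg_iff_eq_star_mul_self.1 hM.nonneg
  rw [Matrix.star_eq_conjTranspose]
  have hu : IsUnit A.det := (Matrix.isUnit_iff_isUnit_det A).1 hA.isUnit
  have h1 : A + Bᴴ * B = A * (1 + A⁻¹ * Bᴴ * B) := by
    rw [mul_add, mul_one, ← mul_assoc, ← mul_assoc, Matrix.mul_nonsing_inv A hu, one_mul]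
  rw [h1, Matrix.det_mul, Matrix.det_one_add_mul_comm, ← mul_assoc]
  have h2 : (B * A⁻¹ * Bᴴ).PosSemidef := hA.inv.posSemidef.mul_mul_conjTranspose_same B
  exact le_mul_of_one_le_right hA.det_pos.le (one_le_det_one_add_of_posSemidef h2)

/-- The determinant `det (I + c H Hᴴ)` of a channel, whose logarithm is the mutual information. -/
def channelDet [Fintype p] [Fintype q] [DecidableEq p]
    (c : ℝ) (H : Matrix p q ℂ) : ℝ :=
  (Matrix.det (1 + (c : ℂ) • (H * Hᴴ))).re

theorem posSemidef_smul_of_nonneg {c : ℝ} (hc : 0 ≤ c) {P : Matrix p p ℂ} (hP : P.PosSemidef) :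
    ((c : ℂ) • P).PosSemidef :=
  hP.smul (by exact_mod_cast hc)

theorem posDef_one_add_smul [DecidableEq p]
    {c : ℝ} (hc : 0 ≤ c) {P : Matrix p p ℂ} (hP : P.PosSemidef) :
    (1 + (c : ℂ) • P).PosDef :=
  Matrix.PosDef.one.add_posSemidef (posSemidef_smul_of_nonneg hc hP)

theorem det_one_add_smul_mono [Fintype p] [DecidableEq p]
    {c : ℝ} (hc : 0 ≤ c) {P M : Matrix p p ℂ} (hP : P.PosSemidef)
    (hM : M.PosSemidef) :
    (1 + (c : ℂ) • P).det ≤ (1 + (c : ℂ) • (P + M)).det := by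
  rw [smul_add, ← add_assoc]
  exact det_le_det_add_of_posDef (posDef_one_add_smul hc hP) (posSemidef_smul_of_nonneg hc hM)

theorem one_le_channelDet [Fintype p] [Fintype q] [DecidableEq p]
    {c : ℝ} (hc : 0 ≤ c) (H : Matrix p q ℂ) : 1 ≤ channelDet c H := by
  have := one_le_det_one_add_of_posSemidef
    (posSemidef_smul_of_nonneg hc (Matrix.posSemidef_self_mul_conjTranspose H))
  exact (Complex.le_def.1 this).1

theorem channelDet_comm [Fintype p] [Fintype q] [DecidableEq p] [DecidableEq q]
    (c : ℝ) (H : Matrix p q ℂ) :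
    channelDet c H = (Matrix.det (1 + (c : ℂ) • (Hᴴ * H))).re := by
  rw [channelDet, ← Matrix.smul_mul, Matrix.det_one_add_mul_comm, Matrix.mul_smul]

theorem channelDet_transpose [Fintype p] [Fintype q] [DecidableEq p] [DecidableEq q]
    (c : ℝ) (H : Matrix p q ℂ) : channelDet c Hᵀ = channelDet c H := by
  rw [channelDet_comm, channelDet, ← Matrix.det_transpose]
  simp [Matrix.transpose_mul, Matrix.conjTranspose, Matrix.transpose_map]

/-- Whitening with a positive semidefinite matrix dominating `U Uᴴ` increases the determinant. -/
theorem channelDet_mul_le [Fintype p] [Fintype q] [Fintype r] [DecidableEq p]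
    {c : ℝ} (hc : 0 ≤ c) (X : Matrix p q ℂ) (U : Matrix q r ℂ)
    {P : Matrix q q ℂ} (hP : (P - U * Uᴴ).PosSemidef) :
    channelDet c (X * U) ≤ (Matrix.det (1 + (c : ℂ) • (X * P * Xᴴ))).re := by
  have h1 : X * P * Xᴴ = (X * U) * (X * U)ᴴ + X * (P - U * Uᴴ) * Xᴴ := by
    rw [Matrix.conjTranspose_mul]
    simp only [Matrix.mul_sub, Matrix.sub_mul, Matrix.mul_assoc]
    abel
  rw [h1]
  exact (Complex.le_def.1 (det_one_add_smul_mono hc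
    (Matrix.posSemidef_self_mul_conjTranspose (X * U)) (hP.mul_mul_conjTranspose_same X))).1

/-- One step of Gram–Schmidt orthogonalization of the rows of a channel matrix, as a lower bound
for the determinant. -/
theorem channelDet_ge_mul_channelDet_succ {c : ℝ} (hc : 0 ≤ c) {m k n : ℕ}
    (Y : Matrix (Fin (m + 1)) (Fin k) ℂ) (U : Matrix (Fin k) (Fin n) ℂ) (hU : Uᴴ * U = 1)
    (hg : Y 0 ᵥ* U = 0) :
    (1 + c * ∑ i, ‖Y 0 i‖ ^ 2) * channelDet c (Y.submatrix Fin.succ id * U) ≤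
      channelDet c Y := by
  set g := Y 0
  set X := Y.submatrix Fin.succ id with hX
  set R : Matrix (Fin 1) (Fin k) ℂ := Matrix.of fun _ => g with hR
  set M : Matrix (Fin k) (Fin k) ℂ := 1 + (c : ℂ) • (Rᴴ * R) with hM
  have hRU : R * U = 0 := by
    ext i j
    exact congrFun hg j
  have hMpd : M.PosDef := posDef_one_add_smul hc (Matrix.posSemidef_conjTranspose_mul_self R)
  have hMu : IsUnit M.det := (Matrix.isUnit_iff_isUnit_det M).1 hMpd.isUnit
  have hdM : M.det = ((1 + c * ∑ i, ‖g i‖ ^ 2 : ℝ) : ℂ) := by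
    rw [hM, ← Matrix.smul_mul, Matrix.det_one_add_mul_comm, Matrix.mul_smul]
    simp [Matrix.mul_apply, hR, Complex.mul_conj, Complex.normSq_eq_norm_sq]
  -- Since `Yᴴ Y = Rᴴ R + Xᴴ X`, the matrix `M` of the first row factors out exactly. The other rows
  -- remain, whitened by `M⁻¹`.
  have hdec : channelDet c Y
      = (1 + c * ∑ i, ‖g i‖ ^ 2) * (Matrix.det (1 + (c : ℂ) • (X * M⁻¹ * Xᴴ))).re := by
    have h1 : (1 + (c : ℂ) • (Yᴴ * Y)) =
        M * (1 + M⁻¹ * ((c : ℂ) • Xᴴ) * X) := by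
      rw [Matrix.mul_add, Matrix.mul_one, ← Matrix.mul_assoc, ← Matrix.mul_assoc,
        Matrix.mul_nonsing_inv M hMu, Matrix.one_mul, hM, add_assoc, Matrix.smul_mul, ← smul_add]
      congr 2
      ext i j
      simp [Matrix.mul_apply, Fin.sum_univ_succ, hR, hX, g]
    rw [channelDet_comm, h1, Matrix.det_mul, hdM, Matrix.det_one_add_mul_comm, Complex.re_ofReal_mul]
    simp [Matrix.mul_assoc]
  rw [hdec]
  have hpos : 0 ≤ 1 + c * ∑ i, ‖g i‖ ^ 2 := by positivity
  refine mul_le_mul_of_nonneg_left (channelDet_mul_le hc X U ?_) hpos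
  -- The columns of `U` are annihilated by `R`, so `M` fixes them. Hence `M⁻¹ - U Uᴴ` is the
  -- compression of `M⁻¹` by `1 - U Uᴴ`, which is positive semidefinite.
  have hMU : M⁻¹ * U = U := by
    have : M * U = U := by
      rw [hM, Matrix.add_mul, Matrix.one_mul, Matrix.smul_mul, Matrix.mul_assoc, hRU]; simp
    conv_lhs => rw [← this]
    rw [← Matrix.mul_assoc, Matrix.nonsing_inv_mul M hMu, Matrix.one_mul]
  have hMH : M⁻¹ᴴ = M⁻¹ := hMpd.inv.1
  have hUM : Uᴴ * M⁻¹ = Uᴴ := by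
    have := congrArg Matrix.conjTranspose hMU
    rwa [Matrix.conjTranspose_mul, hMH] at this
  have h2 : M⁻¹ - U * Uᴴ = (1 - U * Uᴴ) * M⁻¹ * (1 - U * Uᴴ)ᴴ := by
    rw [Matrix.conjTranspose_sub, Matrix.conjTranspose_mul, Matrix.conjTranspose_conjTranspose,
      Matrix.conjTranspose_one, Matrix.sub_mul, Matrix.one_mul, Matrix.mul_assoc, hUM, Matrix.mul_sub,
      Matrix.mul_one, Matrix.sub_mul, ← Matrix.mul_assoc M⁻¹, hMU, Matrix.mul_assoc U,
      ← Matrix.mul_assoc Uᴴ, hU, Matrix.one_mul, sub_self, sub_zero]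
  rw [h2]
  exact hMpd.inv.posSemidef.mul_mul_conjTranspose_same _

/-- The kernel of a matrix with `a` rows and `k` columns contains `n` orthonormal vectors as soon as
`a + n ≤ k`. -/
theorem exists_isometry_mul_eq_zero {a k n : ℕ} (h : a + n ≤ k) (H : Matrix (Fin a) (Fin k) ℂ) :
    ∃ U : Matrix (Fin k) (Fin n) ℂ, Uᴴ * U = 1 ∧ H * U = 0 := by
  set K := LinearMap.ker (Matrix.toEuclideanLin H)
  have hd : n ≤ Module.finrank ℂ K := by
    have h1 := LinearMap.finrank_range_add_finrank_ker (Matrix.toEuclideanLin H)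
    have h2 := Submodule.finrank_le (LinearMap.range (Matrix.toEuclideanLin H))
    simp only [finrank_euclideanSpace, Fintype.card_fin] at h1 h2
    change _ ≤ Module.finrank ℂ (LinearMap.ker (Matrix.toEuclideanLin H))
    omega
  set b := stdOrthonormalBasis ℂ K
  set v : Fin n → EuclideanSpace ℂ (Fin k) := fun j => (b (Fin.castLE hd j) : EuclideanSpace ℂ (Fin k))
  refine ⟨Matrix.of fun i j => v j i, ?_, ?_⟩
  · ext i j
    have h1 : inner ℂ (v i) (v j) = if i = j then (1 : ℂ) else 0 := by
      have := orthonormal_iff_ite.1 b.orthonormal (Fin.castLE hd i) (Fin.castLE hd j)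
      rw [Submodule.coe_inner] at this
      simp only [v, this, Fin.castLE_inj]
    rw [Matrix.one_apply, ← h1, PiLp.inner_apply]
    simp [Matrix.mul_apply, mul_comm]
  · ext i j
    have h1 : Matrix.toEuclideanLin H (v j) = 0 := (b (Fin.castLE hd j)).2
    have h2 := congrArg (fun w : EuclideanSpace ℂ (Fin a) => w i) h1
    simpa [Matrix.mul_apply, Matrix.toLpLin_apply, Matrix.mulVec, dotProduct] using h2

/-- The matrix of the orthogonal projection onto the kernel of a full-row-rank matrix. -/
noncomputable def kerProj [Fintype p] [Fintype q] [DecidableEq p] [DecidableEq q]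
    (H : Matrix p q ℂ) : Matrix q q ℂ := 1 - Hᴴ * (H * Hᴴ)⁻¹ * H

theorem kerProj_conjTranspose [Fintype p] [Fintype q] [DecidableEq p] [DecidableEq q]
    (H : Matrix p q ℂ) : (kerProj H)ᴴ = kerProj H := by
  simp [kerProj, Matrix.conjTranspose_nonsing_inv, Matrix.mul_assoc]

theorem kerProj_mul_self [Fintype p] [Fintype q] [DecidableEq p] [DecidableEq q]
    (H : Matrix p q ℂ) : kerProj H * kerProj H = kerProj H := by
  -- In the singular case the inverse is `0` by convention, so the identity needs no rank
  -- assumption.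
  have h1 : (H * Hᴴ)⁻¹ * (H * Hᴴ) * (H * Hᴴ)⁻¹ = (H * Hᴴ)⁻¹ := by
    by_cases h : IsUnit (H * Hᴴ).det
    · rw [Matrix.nonsing_inv_mul _ h, one_mul]
    · rw [Matrix.nonsing_inv_apply_not_isUnit _ h]; simp
  have h2 : Hᴴ * (H * Hᴴ)⁻¹ * H * (Hᴴ * (H * Hᴴ)⁻¹ * H) =
      Hᴴ * ((H * Hᴴ)⁻¹ * (H * Hᴴ) * (H * Hᴴ)⁻¹) * H := by simp only [Matrix.mul_assoc]
  rw [h1] at h2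
  simp only [kerProj, sub_mul, mul_sub, one_mul, mul_one, h2]
  abel

/-- `kerProj H` fixes the columns of `U`, so the difference is a Hermitian idempotent `D = Dᴴ D`.
This remains true for rank-deficient `H`, where `kerProj H = 1`. -/
theorem kerProj_sub_posSemidef [Fintype p] [Fintype q] [Fintype r] [DecidableEq p] [DecidableEq q]
    [DecidableEq r]
    {H : Matrix p q ℂ} {U : Matrix q r ℂ} (hU : Uᴴ * U = 1)
    (hHU : H * U = 0) : (kerProj H - U * Uᴴ).PosSemidef := by
  have h1 : kerProj H * U = U := by
    rw [kerProj, Matrix.sub_mul, Matrix.one_mul, Matrix.mul_assoc _ H U, hHU]; simp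
  have h2 : Uᴴ * kerProj H = Uᴴ := by
    have := congrArg Matrix.conjTranspose h1
    rwa [Matrix.conjTranspose_mul, kerProj_conjTranspose] at this
  have h3 : kerProj H - U * Uᴴ = (kerProj H - U * Uᴴ)ᴴ * (kerProj H - U * Uᴴ) := by
    rw [Matrix.conjTranspose_sub, kerProj_conjTranspose, Matrix.conjTranspose_mul,
      Matrix.conjTranspose_conjTranspose, sub_mul, mul_sub, mul_sub, kerProj_mul_self,
      ← Matrix.mul_assoc, h1, Matrix.mul_assoc U Uᴴ (kerProj H), h2, Matrix.mul_assoc U,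
      ← Matrix.mul_assoc Uᴴ, hU, Matrix.one_mul]
    abel
  rw [h3]
  exact Matrix.posSemidef_conjTranspose_mul_self _

/-- The existence of the precoder already forces full row rank: `A Aᴴ` has rank at most `Nt - Ne`,
so the kernel is no larger than that. Almost sure full rank of `He` thus needs no Gaussian
computation. -/
theorem IsZFPrecoder.mul_conjTranspose_eq {Nt Ne : ℕ} (hN : Ne < Nt)
    {H : Matrix (Fin Ne) (Fin Nt) ℂ} {A : Matrix (Fin Nt) (Fin (Nt - Ne)) ℂ}
    (h : IsZFPrecoder H A) : A * Aᴴ = kerProj H := by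
  set K := LinearMap.ker (Matrix.toEuclideanLin H) with hK
  have happ : ∀ v : EuclideanSpace ℂ (Fin Nt),
      WithLp.toLp 2 ((A * Aᴴ) *ᵥ v.ofLp) = K.starProjection v := fun v => by
    rw [← (show Matrix.toEuclideanCLM (𝕜 := ℂ) (A * Aᴴ) = K.starProjection from h)]; rfl
  have hrankA : Module.finrank ℂ K ≤ Nt - Ne := by
    have h1 : K ≤ LinearMap.range (Matrix.toEuclideanLin (A * Aᴴ)) := fun v hv =>
      ⟨v, (happ v).trans (Submodule.starProjection_eq_self_iff.2 hv)⟩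
    have h2 := Submodule.finrank_mono h1
    have h3 : Module.finrank ℂ (LinearMap.range (Matrix.toEuclideanLin (A * Aᴴ))) =
      (A * Aᴴ).rank := (Matrix.rank_eq_finrank_range_toLin (A * Aᴴ)
        (PiLp.basisFun 2 ℂ (Fin Nt)) (PiLp.basisFun 2 ℂ (Fin Nt))).symm
    have h4 : (A * Aᴴ).rank ≤ Nt - Ne := by
      refine (Matrix.rank_mul_le_left A Aᴴ).trans ?_
      simpa using A.rank_le_width
    rw [h3] at h2
    exact h2.trans h4
  have hrankH : H.rank = Ne := by
    have h1 := LinearMap.finrank_range_add_finrank_ker (Matrix.toEuclideanLin H)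
    have h3 : Module.finrank ℂ (LinearMap.range (Matrix.toEuclideanLin H)) =
      H.rank := (Matrix.rank_eq_finrank_range_toLin H
        (PiLp.basisFun 2 ℂ (Fin Ne)) (PiLp.basisFun 2 ℂ (Fin Nt))).symm
    rw [h3, finrank_euclideanSpace, Fintype.card_fin] at h1
    have h4 : H.rank ≤ Ne := by simpa using H.rank_le_height
    rw [← hK] at h1
    omega
  have hunit : IsUnit (H * Hᴴ).det := by
    rw [← Matrix.isUnit_iff_isUnit_det]
    have h1 : (H * Hᴴ).rank = Fintype.card (Fin Ne) := by
      rw [Matrix.rank_self_mul_conjTranspose, hrankH, Fintype.card_fin]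
    rw [← Matrix.linearIndependent_rows_iff_isUnit, linearIndependent_iff_card_eq_finrank_span,
      ← h1, Matrix.rank_eq_finrank_span_row]
    rfl
  have hfix : ∀ v : Fin Nt → ℂ, H *ᵥ v = 0 → (A * Aᴴ) *ᵥ v = v := fun v hv => by
    have h1 : WithLp.toLp 2 v ∈ K := by
      rw [hK, LinearMap.mem_ker, Matrix.toLpLin_apply]; simp [hv]
    have h2 := (happ (WithLp.toLp 2 v)).trans (Submodule.starProjection_eq_self_iff.2 h1)
    exact congrArg WithLp.ofLp h2
  have hker : H * (A * Aᴴ) = 0 := by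
    refine Matrix.ext_of_mulVec_single fun i => ?_
    have h1 := Submodule.starProjection_apply_mem K (WithLp.toLp 2 (Pi.single i 1))
    rw [← happ, hK, LinearMap.mem_ker, Matrix.toLpLin_apply] at h1
    have h2 := congrArg WithLp.ofLp h1
    rw [Matrix.zero_mulVec]
    simpa only [Matrix.mulVec_mulVec, WithLp.ofLp_zero] using h2
  have hker' : (A * Aᴴ) * Hᴴ = 0 := by
    have := congrArg Matrix.conjTranspose hker
    simpa [Matrix.mul_assoc] using this
  -- The product is evaluated in two ways: `A Aᴴ` fixes the kernel, which contains the columns of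
  -- `kerProj H`, and `A Aᴴ` kills `Hᴴ`.
  have h1 : (A * Aᴴ) * kerProj H = kerProj H := by
    refine Matrix.ext_of_mulVec_single fun i => ?_
    rw [← Matrix.mulVec_mulVec]
    refine hfix _ ?_
    rw [Matrix.mulVec_mulVec, kerProj, Matrix.mul_sub, Matrix.mul_one, ← Matrix.mul_assoc,
      ← Matrix.mul_assoc, Matrix.mul_nonsing_inv _ hunit, Matrix.one_mul, sub_self,
      Matrix.zero_mulVec]
  rw [← h1, kerProj, Matrix.mul_sub, Matrix.mul_one, ← Matrix.mul_assoc, ← Matrix.mul_assoc, hker']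
  simp

end MatrixPart

/-! ### Complex Gaussian vectors and the Gamma law of their norm -/

section GaussianPart

instance : IsProbabilityMeasure complexGaussian :=
  Measure.isProbabilityMeasure_map Complex.measurableEquivRealProd.symm.measurable.aemeasurable

/-- The law of a vector of independent `𝒞𝒩(0, 1)` entries. -/
noncomputable def gaussianVec (ι : Type*) [Fintype ι] : Measure (ι → ℂ) :=
  Measure.pi fun _ => complexGaussian

instance (ι : Type*) [Fintype ι] : IsProbabilityMeasure (gaussianVec ι) := by
  unfold gaussianVec; infer_instance

theorem integral_exp_re_mul_complexGaussian (w : ℂ) :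
    ∫ z, Complex.exp (((w * z).re : ℝ) * Complex.I) ∂complexGaussian =
      Complex.exp (-(‖w‖ ^ 2 / 4 : ℝ)) := by
  rw [complexGaussian, integral_map_equiv]
  have h1 : ∀ p : ℝ × ℝ, Complex.exp (((w * Complex.measurableEquivRealProd.symm p).re : ℝ) *
      Complex.I) = Complex.exp (w.re * p.1 * Complex.I) * Complex.exp ((-w.im : ℝ) * p.2 * Complex.I) := by
    intro p
    rw [← Complex.exp_add]
    congr 1
    simp [Complex.measurableEquivRealProd, Complex.mul_re]
    ring
  simp_rw [h1]
  rw [integral_prod_mul (f := fun x : ℝ => Complex.exp (w.re * x * Complex.I))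
    (g := fun x : ℝ => Complex.exp ((-w.im : ℝ) * x * Complex.I)), ← charFun_apply_real,
    ← charFun_apply_real, charFun_gaussianReal, charFun_gaussianReal, ← Complex.exp_add]
  congr 1
  rw [← Complex.normSq_eq_norm_sq, Complex.normSq_apply]
  push_cast
  ring_nf

theorem integral_exp_re_sum_gaussianVec {ι : Type*} [Fintype ι] (w : ι → ℂ) :
    ∫ x, Complex.exp (((∑ i, w i * x i).re : ℝ) * Complex.I) ∂gaussianVec ι =
      Complex.exp (-((∑ i, ‖w i‖ ^ 2) / 4 : ℝ)) := by
  have h1 : ∀ x : ι → ℂ, Complex.exp (((∑ i, w i * x i).re : ℝ) * Complex.I) =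
      ∏ i, Complex.exp (((w i * x i).re : ℝ) * Complex.I) := by
    intro x
    rw [← Complex.exp_sum, Complex.re_sum, Complex.ofReal_sum, Finset.sum_mul]
  simp_rw [h1]
  rw [gaussianVec, integral_fintype_prod_eq_prod
    (f := fun i z => Complex.exp (((w i * z).re : ℝ) * Complex.I))]
  simp_rw [integral_exp_re_mul_complexGaussian]
  rw [← Complex.exp_sum]
  congr 1
  push_cast
  rw [Finset.sum_neg_distrib, Finset.sum_div]

/-- Characteristic functions test against real-linear functionals; this form lets the complex matrix
`U` act on them. -/
theorem exists_dual_eq_re_sum {ι : Type*} [Fintype ι] [DecidableEq ι] (L : StrongDual ℝ (ι → ℂ)) :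
    ∃ w : ι → ℂ, ∀ x, L x = (∑ i, w i * x i).re := by
  refine ⟨fun i => ⟨L (Pi.single i 1), -L (Pi.single i Complex.I)⟩, fun x => ?_⟩
  have hx : x = ∑ i, ((x i).re • (Pi.single i 1 : ι → ℂ) +
      (x i).im • (Pi.single i Complex.I : ι → ℂ)) := by
    have h1 : ∀ i, ((x i).re • (Pi.single i 1 : ι → ℂ) +
      (x i).im • (Pi.single i Complex.I : ι → ℂ)) = Pi.single i (x i) := by
      intro i
      rw [← Pi.single_smul, ← Pi.single_smul, ← Pi.single_add]
      congr 1
      simp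
    simp_rw [h1]
    exact (Finset.univ_sum_single x).symm
  conv_lhs => rw [hx]
  rw [map_sum, Complex.re_sum]
  refine Finset.sum_congr rfl fun i _ => ?_
  simp [Complex.mul_re]
  ring

/-- The iid complex Gaussian law is invariant under matrices with orthonormal columns. -/
theorem gaussianVec_map_vecMul {k r : ℕ} {U : Matrix (Fin k) (Fin r) ℂ} (hU : Uᴴ * U = 1) :
    (gaussianVec (Fin k)).map (fun x => x ᵥ* U) = gaussianVec (Fin r) := by
  have hm : Measurable fun x : Fin k → ℂ => x ᵥ* U := by
    unfold Matrix.vecMul dotProduct; fun_prop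
  have := Measure.isProbabilityMeasure_map (μ := gaussianVec (Fin k)) hm.aemeasurable
  refine Measure.ext_of_charFunDual ?_
  ext L
  obtain ⟨w, hw⟩ := exists_dual_eq_re_sum L
  simp_rw [charFunDual_apply, hw]
  rw [integral_exp_re_sum_gaussianVec, integral_map hm.aemeasurable (by
    refine Continuous.aestronglyMeasurable ?_
    fun_prop)]
  -- The characteristic function depends only on the norm of the coefficient vector, and `w ↦ U w`
  -- is an isometry.
  have h1 : ∀ x : Fin k → ℂ, ∑ i, w i * (x ᵥ* U) i = ∑ j, (U *ᵥ w) j * x j := by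
    intro x
    have := Matrix.dotProduct_mulVec x U w
    simp only [dotProduct] at this
    simp_rw [mul_comm (w _), mul_comm _ (x _)]
    exact this.symm
  simp_rw [h1]
  rw [integral_exp_re_sum_gaussianVec]
  have h2 : ((∑ i, ‖(U *ᵥ w) i‖ ^ 2 : ℝ) : ℂ) = ((∑ i, ‖w i‖ ^ 2 : ℝ) : ℂ) := by
    have h3 : ∀ {n : ℕ} (v : Fin n → ℂ), ((∑ i, ‖v i‖ ^ 2 : ℝ) : ℂ) = star v ⬝ᵥ v := by
      intro n v
      simp [dotProduct, Complex.conj_mul']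
    rw [h3, h3, Matrix.star_mulVec, ← Matrix.dotProduct_mulVec, Matrix.mulVec_mulVec, hU,
      Matrix.one_mulVec]
  rw [Complex.ofReal_inj.1 h2]

/-- The squared modulus of a `𝒞𝒩(0, 1)` variable is exponentially distributed. -/
theorem lintegral_norm_sq_complexGaussian {φ : ℝ → ENNReal} (hφ : Measurable φ) :
    ∫⁻ z, φ (‖z‖ ^ 2) ∂complexGaussian =
      ∫⁻ t in Set.Ioi (0 : ℝ), ENNReal.ofReal (Real.exp (-t)) * φ t := by
  have hpdf : ∀ x : ℝ, gaussianPDF 0 (1 / 2) x =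
      ENNReal.ofReal ((Real.sqrt Real.pi)⁻¹ * Real.exp (-x ^ 2)) := by
    intro x
    rw [gaussianPDF, gaussianPDFReal]
    congr 1
    simp
    field_simp
  have h1 : ∫⁻ z, φ (‖z‖ ^ 2) ∂complexGaussian =
      ∫⁻ p : ℝ × ℝ, ENNReal.ofReal (Real.pi⁻¹ * Real.exp (-(p.1 ^ 2 + p.2 ^ 2))) *
        φ (p.1 ^ 2 + p.2 ^ 2) := by
    rw [complexGaussian, lintegral_map_equiv, gaussianReal_of_var_ne_zero _ (by norm_num),
      prod_withDensity (measurable_gaussianPDF _ _) (measurable_gaussianPDF _ _),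
      lintegral_withDensity_eq_lintegral_mul _ (by
        exact ((measurable_gaussianPDF _ _).comp measurable_fst).mul
          ((measurable_gaussianPDF _ _).comp measurable_snd)) (by
        refine hφ.comp (Measurable.pow_const (Measurable.norm ?_) 2)
        exact Complex.measurableEquivRealProd.symm.measurable)]
    rw [← Measure.volume_eq_prod]
    refine lintegral_congr fun p => ?_
    simp only [Pi.mul_apply, hpdf]
    congr 2
    · rw [← ENNReal.ofReal_mul (by positivity)]
      congr 1
      rw [neg_add, Real.exp_add]
      have : Real.pi⁻¹ = (Real.sqrt Real.pi)⁻¹ * (Real.sqrt Real.pi)⁻¹ := by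
        rw [← mul_inv, Real.mul_self_sqrt Real.pi_pos.le]
      rw [this]; ring
    · rw [← Complex.normSq_eq_norm_sq, Complex.normSq_apply]
      simp [Complex.measurableEquivRealProd]
      ring
  rw [h1, ← lintegral_comp_polarCoord_symm, polarCoord_target]
  have h2 : ∀ p : ℝ × ℝ, ENNReal.ofReal p.1 • (ENNReal.ofReal (Real.pi⁻¹ *
      Real.exp (-((polarCoord.symm p).1 ^ 2 + (polarCoord.symm p).2 ^ 2))) *
        φ ((polarCoord.symm p).1 ^ 2 + (polarCoord.symm p).2 ^ 2)) =
      (ENNReal.ofReal p.1 * (ENNReal.ofReal (Real.pi⁻¹ * Real.exp (-p.1 ^ 2)) * φ (p.1 ^ 2))) * 1 := by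
    intro p
    have : (polarCoord.symm p).1 ^ 2 + (polarCoord.symm p).2 ^ 2 = p.1 ^ 2 := by
      rw [polarCoord_symm_apply]
      nlinarith [Real.sin_sq_add_cos_sq p.2]
    rw [this, smul_eq_mul, mul_one]
  simp_rw [h2]
  rw [Measure.volume_eq_prod, ← Measure.prod_restrict, lintegral_prod_mul
    (f := fun r : ℝ => ENNReal.ofReal r * (ENNReal.ofReal (Real.pi⁻¹ * Real.exp (-r ^ 2)) *
      φ (r ^ 2))) (g := fun _ => 1) (by fun_prop) (by fun_prop)]
  -- Substitution `t = r²`: the Jacobian `2 r` matches the polar factor `r`, the normalization `π⁻¹`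
  -- and the angular length `2 π`.
  have h3 : Set.Ioi (0 : ℝ) = (fun r : ℝ => r ^ 2) '' Set.Ioi 0 := by
    ext t
    simp only [Set.mem_Ioi, Set.mem_image]
    refine ⟨fun ht => ⟨Real.sqrt t, Real.sqrt_pos.2 ht, Real.sq_sqrt ht.le⟩, ?_⟩
    rintro ⟨r, hr, rfl⟩; positivity
  conv_rhs => rw [h3]
  rw [lintegral_image_eq_lintegral_abs_deriv_mul (f' := fun r => 2 * r) measurableSet_Ioi
    (fun r _ => by simpa using (hasDerivAt_pow 2 r).hasDerivWithinAt)
    (fun a ha b hb hab => (sq_eq_sq₀ (Set.mem_Ioi.1 ha).le (Set.mem_Ioi.1 hb).le).1 hab)]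
  rw [← lintegral_mul_const _ (by fun_prop)]
  refine setLIntegral_congr_fun measurableSet_Ioi fun r hr => ?_
  have hr' : (0 : ℝ) < r := hr
  simp only [lintegral_const, Measure.restrict_apply MeasurableSet.univ, Set.univ_inter,
    Real.volume_Ioo, one_mul]
  rw [← mul_assoc, ← mul_assoc, mul_right_comm _ (φ (r ^ 2)), ← ENNReal.ofReal_mul hr'.le,
    ← ENNReal.ofReal_mul (by positivity), ← ENNReal.ofReal_mul (by positivity),
    abs_of_pos (by positivity)]
  congr 2
  field_simp
  ring

/-- The distribution function of the sum of `k` independent standard exponential variables. -/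
noncomputable def erlangCDF (k : ℕ) (s : ℝ) : ℝ :=
  1 - Real.exp (-s) * ∑ j ∈ Finset.range k, s ^ j / (j.factorial : ℝ)

theorem erlangCDF_nonneg (k : ℕ) {s : ℝ} (hs : 0 ≤ s) : 0 ≤ erlangCDF k s := by
  have h1 := Real.sum_le_exp_of_nonneg hs k
  have h2 : Real.exp (-s) * Real.exp s = 1 := by rw [← Real.exp_add]; simp
  have h3 := mul_le_mul_of_nonneg_left h1 (Real.exp_pos (-s)).le
  unfold erlangCDF
  linarith

theorem erlangCDF_succ_zero (k : ℕ) : erlangCDF (k + 1) 0 = 0 := by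
  simp [erlangCDF, Finset.sum_range_succ']

theorem continuous_erlangCDF (k : ℕ) : Continuous (erlangCDF k) := by
  unfold erlangCDF; fun_prop

theorem hasDerivAt_sum_pow_div_factorial (k : ℕ) (s : ℝ) :
    HasDerivAt (fun s : ℝ => ∑ j ∈ Finset.range (k + 1), s ^ j / (j.factorial : ℝ))
      (∑ j ∈ Finset.range k, s ^ j / (j.factorial : ℝ)) s := by
  have h1 : ∀ j ∈ Finset.range (k + 1), HasDerivAt (fun s : ℝ => s ^ j / (j.factorial : ℝ))
      ((j : ℝ) * s ^ (j - 1) / (j.factorial : ℝ)) s := fun j _ => (hasDerivAt_pow j s).div_const _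
  refine (HasDerivAt.fun_sum h1).congr_deriv ?_
  rw [Finset.sum_range_succ']
  simp only [Nat.cast_zero, zero_mul, zero_div, add_zero]
  refine Finset.sum_congr rfl fun j _ => ?_
  rw [Nat.factorial_succ]
  push_cast
  field_simp

theorem hasDerivAt_erlangCDF_succ (k : ℕ) (s : ℝ) :
    HasDerivAt (erlangCDF (k + 1)) (erlangCDF k s - erlangCDF (k + 1) s) s := by
  have h1 := (((hasDerivAt_id s).neg.exp).mul (hasDerivAt_sum_pow_div_factorial k s)).const_sub 1
  refine h1.congr_deriv ?_
  simp only [erlangCDF, id, Pi.neg_apply]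
  ring

theorem gammaInc_succ_eq_erlangCDF (k : ℕ) (s : ℝ) : gammaInc s (k + 1) = erlangCDF (k + 1) s := by
  have h1 : ∀ t : ℝ, HasDerivAt (erlangCDF (k + 1))
      (1 / (k.factorial : ℝ) * (t ^ k * Real.exp (-t))) t := by
    intro t
    refine (hasDerivAt_erlangCDF_succ k t).congr_deriv ?_
    simp only [erlangCDF, Finset.sum_range_succ]
    ring
  have h2 := intervalIntegral.integral_eq_sub_of_hasDerivAt (a := 0) (b := s) (fun t _ => h1 t)
    (Continuous.intervalIntegrable (by fun_prop) _ _)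
  rw [erlangCDF_succ_zero, sub_zero, intervalIntegral.integral_const_mul] at h2
  rw [← h2, gammaInc, Nat.add_sub_cancel]

/-- Convolution with the exponential density; `F_{k+1}' = F_k - F_{k+1}` provides the antiderivative
`-e^{-t} F_{k+1}(s - t)`. -/
theorem integral_exp_mul_erlangCDF (k : ℕ) (s : ℝ) :
    ∫ t in (0 : ℝ)..s, Real.exp (-t) * erlangCDF k (s - t) = erlangCDF (k + 1) s := by
  have h1 : ∀ t : ℝ, HasDerivAt (fun t => -(Real.exp (-t) * erlangCDF (k + 1) (s - t)))
      (Real.exp (-t) * erlangCDF k (s - t)) t := by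
    intro t
    have h2 := (hasDerivAt_erlangCDF_succ k (s - t)).comp t ((hasDerivAt_id t).const_sub s)
    refine (((hasDerivAt_id t).neg.exp).mul h2).neg.congr_deriv ?_
    simp only [id, Pi.neg_apply, Function.comp]
    ring
  rw [intervalIntegral.integral_eq_sub_of_hasDerivAt (fun t _ => h1 t)
    (Continuous.intervalIntegrable (by have := continuous_erlangCDF k; fun_prop) _ _)]
  simp [erlangCDF_succ_zero]

/-- Induction splits off one coordinate, whose squared modulus is exponential, and convolves. Strict
`0 < s` serves the base case: the empty sum lies below `s` with probability `erlangCDF 0 s = 1`. -/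
theorem gaussianVec_sum_norm_sq_lt_of_pos (k : ℕ) {s : ℝ} (hs : 0 < s) :
    gaussianVec (Fin k) {x | ∑ i, ‖x i‖ ^ 2 < s} = ENNReal.ofReal (erlangCDF k s) := by
  induction k generalizing s with
  | zero => simp [erlangCDF, hs]
  | succ k ih =>
    have hmp := measurePreserving_piFinSuccAbove (fun _ : Fin (k + 1) => complexGaussian) 0
    set S : Set (ℂ × (Fin k → ℂ)) := {p | ‖p.1‖ ^ 2 + ∑ i, ‖p.2 i‖ ^ 2 < s} with hS
    have hSm : MeasurableSet S := measurableSet_lt (by fun_prop) measurable_const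
    have h1 : {x : Fin (k + 1) → ℂ | ∑ i, ‖x i‖ ^ 2 < s} =
        MeasurableEquiv.piFinSuccAbove (fun _ => ℂ) 0 ⁻¹' S := by
      ext x
      simp [hS, Fin.sum_univ_succ, MeasurableEquiv.piFinSuccAbove, Fin.tail]
    rw [gaussianVec, h1, hmp.measure_preimage_equiv, Measure.prod_apply hSm]
    set φ : ℝ → ENNReal := (Set.Iio s).indicator fun t => ENNReal.ofReal (erlangCDF k (s - t))
    have hφ : Measurable φ := by
      refine Measurable.indicator ?_ measurableSet_Iio
      have := (continuous_erlangCDF k).measurable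
      fun_prop
    have h2 : ∀ z : ℂ, Measure.pi (fun _ : Fin k => complexGaussian) (Prod.mk z ⁻¹' S) =
        φ (‖z‖ ^ 2) := by
      intro z
      have h3 : Prod.mk z ⁻¹' S = {x : Fin k → ℂ | ∑ i, ‖x i‖ ^ 2 < s - ‖z‖ ^ 2} := by
        ext x; simp [hS, lt_sub_iff_add_lt']
      rw [h3]
      by_cases hz : ‖z‖ ^ 2 < s
      · have h4 : φ (‖z‖ ^ 2) = ENNReal.ofReal (erlangCDF k (s - ‖z‖ ^ 2)) :=
          Set.indicator_of_mem (Set.mem_Iio.2 hz) _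
        rw [h4]
        exact ih (sub_pos.2 hz)
      · have h4 : φ (‖z‖ ^ 2) = 0 := Set.indicator_of_notMem (show ‖z‖ ^ 2 ∉ Set.Iio s from hz) _
        rw [h4]
        convert measure_empty (μ := Measure.pi fun _ : Fin k => complexGaussian)
        refine Set.eq_empty_of_forall_notMem fun x hx => ?_
        have h4 : 0 ≤ ∑ i, ‖x i‖ ^ 2 := by positivity
        have h5 : ∑ i, ‖x i‖ ^ 2 < s - ‖z‖ ^ 2 := hx
        linarith
    refine (lintegral_congr h2).trans ?_
    rw [lintegral_norm_sq_complexGaussian hφ]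
    have h6 : ∀ t, ENNReal.ofReal (Real.exp (-t)) * φ t = (Set.Iio s).indicator
        (fun t => ENNReal.ofReal (Real.exp (-t) * erlangCDF k (s - t))) t := by
      intro t
      by_cases ht : t ∈ Set.Iio s
      · simp only [φ, Set.indicator_of_mem ht]
        rw [ENNReal.ofReal_mul (Real.exp_pos _).le]
      · simp only [φ, Set.indicator_of_notMem ht, mul_zero]
    simp_rw [h6]
    rw [lintegral_indicator measurableSet_Iio, Measure.restrict_restrict measurableSet_Iio,
      Set.inter_comm, Set.Ioi_inter_Iio, restrict_Ioo_eq_restrict_Ioc,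
      ← integral_exp_mul_erlangCDF, intervalIntegral.integral_of_le hs.le,
      ofReal_integral_eq_lintegral_ofReal]
    · refine (Continuous.integrableOn_Icc ?_).mono_set Set.Ioc_subset_Icc_self
      have := continuous_erlangCDF k
      fun_prop
    · refine (ae_restrict_iff' measurableSet_Ioc).2 (Filter.Eventually.of_forall fun t ht => ?_)
      exact mul_nonneg (Real.exp_pos _).le (erlangCDF_nonneg k (sub_nonneg.2 ht.2))

/-- The squared norm of an iid complex Gaussian vector is Gamma distributed. -/
theorem gaussianVec_sum_norm_sq_lt (k : ℕ) {s : ℝ} (hs : 0 ≤ s) :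
    gaussianVec (Fin (k + 1)) {x | ∑ i, ‖x i‖ ^ 2 < s} = ENNReal.ofReal (gammaInc s (k + 1)) := by
  rcases hs.eq_or_lt with rfl | hs
  · rw [gammaInc]
    simp only [intervalIntegral.integral_same, mul_zero, ENNReal.ofReal_zero]
    convert measure_empty (μ := gaussianVec (Fin (k + 1)))
    refine Set.eq_empty_of_forall_notMem fun x hx => ?_
    have h1 : 0 ≤ ∑ i, ‖x i‖ ^ 2 := by positivity
    exact absurd hx (not_lt.2 h1)
  · rw [gammaInc_succ_eq_erlangCDF, gaussianVec_sum_norm_sq_lt_of_pos _ hs]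

theorem gammaInc_nonneg {s : ℝ} (hs : 0 ≤ s) (a : ℕ) : 0 ≤ gammaInc s a := by
  unfold gammaInc
  refine mul_nonneg (by positivity) (intervalIntegral.integral_nonneg hs fun t ht => ?_)
  have := ht.1
  positivity

theorem gammaInc_mono {s t : ℝ} (hs : 0 ≤ s) (hst : s ≤ t) (a : ℕ) :
    gammaInc s a ≤ gammaInc t a := by
  unfold gammaInc
  refine mul_le_mul_of_nonneg_left ?_ (by positivity)
  refine intervalIntegral.integral_mono_interval le_rfl hs hst ?_
    (Continuous.intervalIntegrable (by fun_prop) _ _)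
  refine (ae_restrict_iff' measurableSet_Ioc).2 (Filter.Eventually.of_forall fun x hx => ?_)
  have := hx.1.le
  simp only [Pi.zero_apply]
  positivity

theorem gammaInc_pos {s : ℝ} (hs : 0 < s) (a : ℕ) : 0 < gammaInc s a := by
  unfold gammaInc
  refine mul_pos (by positivity) (intervalIntegral.intervalIntegral_pos_of_pos_on
    (Continuous.intervalIntegrable (by fun_prop) _ _) (fun t ht => ?_) hs)
  have := ht.1
  positivity

end GaussianPart

/-! ### Row-by-row bounds for Gaussian determinants -/

section RandomMatrix

/-- The law of an `m × k` matrix of independent `𝒞𝒩(0, 1)` entries, given by its rows. -/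
noncomputable def gaussianMat (m k : ℕ) : Measure (Fin m → Fin k → ℂ) :=
  Measure.pi fun _ => gaussianVec (Fin k)

instance (m k : ℕ) : IsProbabilityMeasure (gaussianMat m k) := by
  unfold gaussianMat; infer_instance

theorem measurable_channelDet (c : ℝ) (m k : ℕ) :
    Measurable fun x : Fin m → Fin k → ℂ => channelDet c (Matrix.of x) := by
  have h1 : Continuous fun x : Fin m → Fin k → ℂ => (Matrix.of x : Matrix (Fin m) (Fin k) ℂ) :=
    continuous_id
  have h2 : Continuous fun x : Fin m → Fin k → ℂ =>
      Matrix.det (1 + (c : ℂ) • ((Matrix.of x) * (Matrix.of x)ᴴ)) :=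
    Continuous.matrix_det <| Continuous.add continuous_const <|
      (h1.matrix_mul h1.matrix_conjTranspose).const_smul (c : ℂ)
  exact (Complex.continuous_re.comp h2).measurable

theorem measurable_vecMul_rows {m k r : ℕ} (U : Matrix (Fin k) (Fin r) ℂ) :
    Measurable fun (x : Fin m → Fin k → ℂ) (i : Fin m) => x i ᵥ* U := by
  unfold Matrix.vecMul dotProduct
  fun_prop

theorem gaussianMat_map_mul {m k r : ℕ} {U : Matrix (Fin k) (Fin r) ℂ} (hU : Uᴴ * U = 1) :
    (gaussianMat m k).map (fun x i => x i ᵥ* U) = gaussianMat m r := by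
  have hm : Measurable fun x : Fin k → ℂ => x ᵥ* U := by
    unfold Matrix.vecMul dotProduct; fun_prop
  have : ∀ _ : Fin m, SigmaFinite ((gaussianVec (Fin k)).map fun x => x ᵥ* U) := fun _ => by
    rw [gaussianVec_map_vecMul hU]; infer_instance
  rw [gaussianMat, Measure.pi_map_pi (fun _ => hm.aemeasurable)]
  simp_rw [gaussianVec_map_vecMul hU]
  rfl

/-- Condition on the first row `g`. The isometry `U` depends on `g`, but the remaining rows times
`U` have the same law for every `g`, so no measurable choice of `U` is needed. -/
theorem gaussianMat_channelDet_lt_succ_le {c : ℝ} (hc : 0 ≤ c) (m k : ℕ) (E : ℝ) :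
    gaussianMat (m + 1) (k + 1) {x | channelDet c (Matrix.of x) < E} ≤
      ∫⁻ g, gaussianMat m k {x | channelDet c (Matrix.of x) < E / (1 + c * ∑ i, ‖g i‖ ^ 2)}
        ∂gaussianVec (Fin (k + 1)) := by
  have hmp := measurePreserving_piFinSuccAbove (fun _ : Fin (m + 1) => gaussianVec (Fin (k + 1))) 0
  set e := MeasurableEquiv.piFinSuccAbove (fun _ : Fin (m + 1) => Fin (k + 1) → ℂ) 0
  set S := {x : Fin (m + 1) → Fin (k + 1) → ℂ | channelDet c (Matrix.of x) < E}
  have hS : MeasurableSet S := measurableSet_lt (measurable_channelDet c _ _) measurable_const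
  rw [gaussianMat, ← hmp.symm.measure_preimage_equiv, Measure.prod_apply (e.symm.measurable hS)]
  refine lintegral_mono fun g => ?_
  obtain ⟨U, hU, hgU⟩ := exists_isometry_mul_eq_zero (a := 1) (n := k) (k := k + 1) (by omega)
    (Matrix.of fun _ => g)
  have hpos : 0 < 1 + c * ∑ i, ‖g i‖ ^ 2 := by positivity
  rw [← gaussianMat_map_mul hU, Measure.map_apply (measurable_vecMul_rows U)
    (measurableSet_lt (measurable_channelDet c _ _) measurable_const)]
  refine measure_mono fun x hx => ?_
  have hx' : channelDet c (Matrix.of (e.symm (g, x))) < E := hx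
  have h0 : (Matrix.of (e.symm (g, x)) : Matrix _ _ ℂ) 0 = g := rfl
  have h1 : (Matrix.of (e.symm (g, x)) : Matrix _ _ ℂ).submatrix Fin.succ id = Matrix.of x := rfl
  have h2 := channelDet_ge_mul_channelDet_succ hc (Matrix.of (e.symm (g, x))) U hU
    (by rw [h0]; exact congrFun hgU 0)
  rw [h0, h1] at h2
  refine (lt_div_iff₀' hpos).2 (lt_of_le_of_lt ?_ hx')
  exact h2

theorem gaussianMat_channelDet_lt_of_le_one {c : ℝ} (hc : 0 ≤ c) (m k : ℕ) {E : ℝ} (hE : E ≤ 1) :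
    gaussianMat m k {x | channelDet c (Matrix.of x) < E} = 0 := by
  convert measure_empty (μ := gaussianMat m k)
  refine Set.eq_empty_of_forall_notMem fun x hx => ?_
  exact absurd hx (not_lt.2 (hE.trans (one_le_channelDet hc _)))

theorem measurable_sum_norm_sq (k : ℕ) : Measurable fun g : Fin k → ℂ => ∑ i, ‖g i‖ ^ 2 := by
  fun_prop

/-- Every peeled row must have squared norm below `s`; otherwise the remaining threshold is at most
`1` and the event is empty. Dividing by `1 + c ‖g‖² ≥ 1` preserves `E ≤ 1 + c s`. -/
theorem gaussianMat_channelDet_lt_le_prod {c : ℝ} (hc : 0 < c) {s : ℝ} (hs : 0 ≤ s) {m k : ℕ}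
    (hmk : m ≤ k) {E : ℝ} (hE : E ≤ 1 + c * s) :
    gaussianMat m k {x | channelDet c (Matrix.of x) < E} ≤
      ENNReal.ofReal (∏ l ∈ Finset.range m, gammaInc s (k - l)) := by
  induction m generalizing k E with
  | zero => simpa using prob_le_one
  | succ m ih =>
    obtain ⟨k, rfl⟩ : ∃ j, k = j + 1 := ⟨k - 1, by omega⟩
    refine (gaussianMat_channelDet_lt_succ_le hc.le m k E).trans ?_
    set N := {g : Fin (k + 1) → ℂ | ∑ i, ‖g i‖ ^ 2 < s}
    have hN : MeasurableSet N := measurableSet_lt (measurable_sum_norm_sq _) measurable_const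
    set C := ENNReal.ofReal (∏ l ∈ Finset.range m, gammaInc s (k - l))
    have h1 : ∀ g : Fin (k + 1) → ℂ, gaussianMat m k {x | channelDet c (Matrix.of x) <
        E / (1 + c * ∑ i, ‖g i‖ ^ 2)} ≤ N.indicator (fun _ => C) g := by
      intro g
      have hpos : 0 ≤ ∑ i, ‖g i‖ ^ 2 := by positivity
      have hpos' : 0 < 1 + c * ∑ i, ‖g i‖ ^ 2 := by positivity
      by_cases hg : g ∈ N
      · rw [Set.indicator_of_mem hg]
        refine ih (by omega) ((div_le_iff₀ hpos').2 (hE.trans ?_))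
        exact le_mul_of_one_le_right (by positivity) (by nlinarith)
      · rw [Set.indicator_of_notMem hg, gaussianMat_channelDet_lt_of_le_one hc.le]
        have : s ≤ ∑ i, ‖g i‖ ^ 2 := not_lt.1 hg
        refine (div_le_one hpos').2 (hE.trans ?_)
        gcongr
    refine (lintegral_mono h1).trans ?_
    rw [lintegral_indicator_const hN, gaussianVec_sum_norm_sq_lt k hs,
      ← ENNReal.ofReal_mul (Finset.prod_nonneg fun l _ => gammaInc_nonneg hs _),
      Finset.prod_range_succ']
    simp only [Nat.add_sub_add_right, Nat.sub_zero]
    exact le_rfl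

/-- The Gram–Schmidt bound on the probability that the determinant of a Gaussian channel is
small. -/
theorem gaussianMat_channelDet_lt_le {c : ℝ} (hc : 0 < c) {s : ℝ} (hs : 0 ≤ s) {m k : ℕ}
    (hmk : m ≤ k) {t : ℕ → ℝ} (ht : ∀ l < m, 0 ≤ t l) (hts : ∀ l < m, t l ≤ s) {E : ℝ}
    (hE : E ≤ 1 + c * s) (hEt : E ≤ ∏ l ∈ Finset.range m, (1 + c * t l)) :
    gaussianMat m k {x | channelDet c (Matrix.of x) < E} ≤
      ENNReal.ofReal (∏ l ∈ Finset.range m, gammaInc s (k - l) -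
        ∏ l ∈ Finset.range m, (gammaInc s (k - l) - gammaInc (t l) (k - l))) := by
  induction m generalizing k E t with
  | zero =>
    rw [gaussianMat_channelDet_lt_of_le_one hc.le _ _ (by simpa using hEt)]
    exact zero_le
  | succ m ih =>
    obtain ⟨k, rfl⟩ : ∃ j, k = j + 1 := ⟨k - 1, by omega⟩
    refine (gaussianMat_channelDet_lt_succ_le hc.le m k E).trans ?_
    have ht0 := ht 0 (by omega)
    have hts0 := hts 0 (by omega)
    set N := {g : Fin (k + 1) → ℂ | ∑ i, ‖g i‖ ^ 2 < s}
    have hN : MeasurableSet N := measurableSet_lt (measurable_sum_norm_sq _) measurable_const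
    set T := {g : Fin (k + 1) → ℂ | ∑ i, ‖g i‖ ^ 2 < t 0}
    have hT : MeasurableSet T := measurableSet_lt (measurable_sum_norm_sq _) measurable_const
    set a := ∏ l ∈ Finset.range m, gammaInc s (k - l) with ha
    set b := ∏ l ∈ Finset.range m, (gammaInc s (k - l) - gammaInc (t (l + 1)) (k - l)) with hb
    have ha0 : 0 ≤ a := Finset.prod_nonneg fun l _ => gammaInc_nonneg hs _
    have hba : b ≤ a := by
      refine Finset.prod_le_prod (fun l hl => ?_) (fun l hl => ?_)
      · have hl := Finset.mem_range.1 hl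
        exact sub_nonneg.2 (gammaInc_mono (ht _ (by omega)) (hts _ (by omega)) _)
      · have hl := Finset.mem_range.1 hl
        exact sub_le_self _ (gammaInc_nonneg (ht _ (by omega)) _)
    -- Three cases. On `T` the constraint by `t` is met, leaving only the bound by `s`, with value
    -- `a`. On `N \ T` dividing by `1 + c ‖g‖² ≥ 1 + c t 0` leaves the product over the shifted `t`,
    -- and induction gives `a - b`. Outside `N` the event is empty.
    have h1 : ∀ g : Fin (k + 1) → ℂ, gaussianMat m k {x | channelDet c (Matrix.of x) <
        E / (1 + c * ∑ i, ‖g i‖ ^ 2)} ≤ T.indicator (fun _ => ENNReal.ofReal a) g +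
          (N \ T).indicator (fun _ => ENNReal.ofReal (a - b)) g := by
      intro g
      have hpos : 0 ≤ ∑ i, ‖g i‖ ^ 2 := by positivity
      have hpos' : 0 < 1 + c * ∑ i, ‖g i‖ ^ 2 := by positivity
      have hE' : E / (1 + c * ∑ i, ‖g i‖ ^ 2) ≤ 1 + c * s :=
        (div_le_iff₀ hpos').2 (hE.trans (le_mul_of_one_le_right (by positivity) (by nlinarith)))
      by_cases hgT : g ∈ T
      · rw [Set.indicator_of_mem hgT]
        exact le_add_right (gaussianMat_channelDet_lt_le_prod hc hs (by omega) hE')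
      have htg : t 0 ≤ ∑ i, ‖g i‖ ^ 2 := not_lt.1 hgT
      by_cases hgN : g ∈ N
      · rw [Set.indicator_of_notMem hgT, Set.indicator_of_mem (Set.mem_sdiff_of_mem hgN hgT), zero_add]
        refine ih (t := fun l => t (l + 1)) (by omega) (fun l hl => ht _ (by omega))
          (fun l hl => hts _ (by omega)) hE' ((div_le_iff₀ hpos').2 (hEt.trans ?_))
        rw [Finset.prod_range_succ']
        refine mul_le_mul_of_nonneg_left (by gcongr) (Finset.prod_nonneg fun l hl => ?_)
        have := ht (l + 1) (by have := Finset.mem_range.1 hl; omega)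
        positivity
      · rw [gaussianMat_channelDet_lt_of_le_one hc.le]
        · exact zero_le
        have : s ≤ ∑ i, ‖g i‖ ^ 2 := not_lt.1 hgN
        refine (div_le_one hpos').2 (hE.trans ?_)
        gcongr
    refine (lintegral_mono h1).trans ?_
    have hTN : T ⊆ N := fun g hg => lt_of_lt_of_le hg hts0
    rw [lintegral_add_left (measurable_const.indicator hT), lintegral_indicator_const hT,
      lintegral_indicator_const (hN.diff hT), measure_sdiff hTN hT.nullMeasurableSet
        (measure_ne_top _ _), gaussianVec_sum_norm_sq_lt k hs, gaussianVec_sum_norm_sq_lt k ht0,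
      ← ENNReal.ofReal_sub _ (gammaInc_nonneg ht0 _), ← ENNReal.ofReal_mul ha0,
      ← ENNReal.ofReal_mul (sub_nonneg.2 hba), ← ENNReal.ofReal_add
        (mul_nonneg ha0 (gammaInc_nonneg ht0 _))
        (mul_nonneg (sub_nonneg.2 hba) (sub_nonneg.2 (gammaInc_mono ht0 hts0 _))),
      Finset.prod_range_succ', Finset.prod_range_succ']
    simp only [Nat.add_sub_add_right, Nat.sub_zero]
    -- With `G`, `G₀` the values of `gammaInc` at `s`, `t 0`: `a G₀ + (a - b)(G - G₀) = a G - b (G -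
    -- G₀)`.
    refine ENNReal.ofReal_le_ofReal (le_of_eq ?_)
    rw [← ha, ← hb]
    ring

end RandomMatrix

/-! ### Law of the channels and reduction of the outage event -/

section ChannelLaw

theorem measurePreserving_curry_complexGaussian (m k : ℕ) :
    MeasurePreserving (MeasurableEquiv.curry (Fin m) (Fin k) ℂ)
      (Measure.pi fun _ => complexGaussian) (gaussianMat m k) where
  measurable := MeasurableEquiv.measurable _
  map_eq := by
    have h := Measure.infinitePi_map_curry (ι := Fin m) (κ := Fin k) (fun _ _ => complexGaussian)
    simp only [Measure.infinitePi_eq_pi] at h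
    exact h

theorem gaussianMat_map_swap (m k : ℕ) :
    (gaussianMat m k).map (fun x j i => x i j) = gaussianMat k m := by
  have h1 := (measurePreserving_curry_complexGaussian m k).symm
  have h2 := measurePreserving_piCongrLeft (α := fun _ : Fin k × Fin m => ℂ)
    (fun _ => complexGaussian) (Equiv.prodComm (Fin m) (Fin k))
  have h3 := (measurePreserving_curry_complexGaussian k m).comp (h2.comp h1)
  exact h3.map_eq

theorem measurable_kerProj_apply {a k : ℕ} (i j : Fin k) :
    Measurable fun y : Fin a → Fin k → ℂ => kerProj (Matrix.of y) i j := by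
  have h1 : Continuous fun y : Fin a → Fin k → ℂ => (Matrix.of y : Matrix (Fin a) (Fin k) ℂ) :=
    continuous_id
  have h2 : Continuous fun y : Fin a → Fin k → ℂ =>
      (Matrix.of y : Matrix (Fin a) (Fin k) ℂ) * (Matrix.of y)ᴴ :=
    h1.matrix_mul h1.matrix_conjTranspose
  -- The inverse is discontinuous at singular matrices; adjugate over determinant is still
  -- measurable.
  have h3 : ∀ y : Fin a → Fin k → ℂ, kerProj (Matrix.of y) i j = (1 : Matrix (Fin k) (Fin k) ℂ) i j -
      ((Matrix.of y * (Matrix.of y)ᴴ).det)⁻¹ *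
        ((Matrix.of y)ᴴ * (Matrix.of y * (Matrix.of y)ᴴ).adjugate * Matrix.of y) i j := by
    intro y
    rw [kerProj, Matrix.inv_def, Ring.inverse_eq_inv', Matrix.mul_smul, Matrix.smul_mul,
      Matrix.sub_apply, Matrix.smul_apply, smul_eq_mul]
  simp_rw [h3]
  refine measurable_const.sub (h2.matrix_det.measurable.inv.mul (Continuous.measurable ?_))
  exact ((h1.matrix_conjTranspose.matrix_mul h2.matrix_adjugate).matrix_mul h1).matrix_elem i j

theorem measurable_det_kerProj (c : ℝ) (m a k : ℕ) :
    Measurable fun p : (Fin m → Fin k → ℂ) × (Fin a → Fin k → ℂ) =>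
      (Matrix.det (1 + (c : ℂ) • (Matrix.of p.1 * kerProj (Matrix.of p.2) *
        (Matrix.of p.1)ᴴ))).re := by
  have h1 : Continuous fun p : (Fin m → Fin k → ℂ) × (Fin k → Fin k → ℂ) =>
      (Matrix.of p.1 : Matrix (Fin m) (Fin k) ℂ) := continuous_fst
  have h2 : Continuous fun p : (Fin m → Fin k → ℂ) × (Fin k → Fin k → ℂ) =>
      (Matrix.of p.2 : Matrix (Fin k) (Fin k) ℂ) := continuous_snd
  have h3 : Continuous fun p : (Fin m → Fin k → ℂ) × (Fin k → Fin k → ℂ) =>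
      Matrix.det (1 + (c : ℂ) • (Matrix.of p.1 * Matrix.of p.2 * (Matrix.of p.1)ᴴ)) :=
    Continuous.matrix_det <| Continuous.add continuous_const <|
      ((h1.matrix_mul h2).matrix_mul h1.matrix_conjTranspose).const_smul (c : ℂ)
  have h4 : Measurable fun p : (Fin m → Fin k → ℂ) × (Fin a → Fin k → ℂ) =>
      (p.1, fun i j => kerProj (Matrix.of p.2) i j) :=
    measurable_fst.prodMk (measurable_pi_iff.2 fun i => measurable_pi_iff.2 fun j =>
      (measurable_kerProj_apply i j).comp measurable_snd)
  have h5 : ∀ y : Fin a → Fin k → ℂ,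
      Matrix.of (fun i j => kerProj (Matrix.of y) i j) = kerProj (Matrix.of y) := fun _ => rfl
  have h6 := (Complex.continuous_re.comp h3).measurable.comp h4
  simpa only [Function.comp_def, h5] using h6

variable {Ω : Type*} [MeasurableSpace Ω] {μ : Measure Ω} {Nt Nm Ne : ℕ}
  {Hm : Ω → Matrix (Fin Nm) (Fin Nt) ℂ} {He : Ω → Matrix (Fin Ne) (Fin Nt) ℂ}

/-- The main and the eavesdropper channel are independent Gaussian matrices. -/
theorem IsIIDGaussianChannel.hasLaw [IsProbabilityMeasure μ] (h : IsIIDGaussianChannel μ Hm He) :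
    HasLaw (fun ω => ((fun i j => Hm ω i j, fun i j => He ω i j) :
      (Fin Nm → Fin Nt → ℂ) × (Fin Ne → Fin Nt → ℂ)))
      ((gaussianMat Nm Nt).prod (gaussianMat Ne Nt)) μ := by
  set f : (Fin Nm × Fin Nt) ⊕ (Fin Ne × Fin Nt) → Ω → ℂ :=
    Sum.elim (fun (p : Fin Nm × Fin Nt) (ω : Ω) => Hm ω p.1 p.2)
      (fun (p : Fin Ne × Fin Nt) (ω : Ω) => He ω p.1 p.2) with hf
  have hlaw : ∀ i, HasLaw (f i) complexGaussian μ := by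
    rintro (p | p)
    · exact h.law_main p.1 p.2
    · exact h.law_eve p.1 p.2
  have hae : AEMeasurable (fun ω i => f i ω) μ :=
    aemeasurable_pi_lambda _ fun i => (hlaw i).aemeasurable
  have h1 : μ.map (fun ω i => f i ω) = Measure.pi fun _ => complexGaussian := by
    rw [(iIndepFun_iff_map_fun_eq_pi_map fun i => (hlaw i).aemeasurable).1 h.indep]
    simp_rw [fun i => (hlaw i).map_eq]
  have h2 := measurePreserving_sumPiEquivProdPi
    (X := fun _ : (Fin Nm × Fin Nt) ⊕ (Fin Ne × Fin Nt) => ℂ) (fun _ => complexGaussian)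
  have h3 := ((measurePreserving_curry_complexGaussian Nm Nt).prod
    (measurePreserving_curry_complexGaussian Ne Nt)).comp h2
  refine ⟨h3.measurable.comp_aemeasurable hae, ?_⟩
  rw [← h3.map_eq, ← h1, AEMeasurable.map_map_of_aemeasurable h3.measurable.aemeasurable hae]
  rfl

theorem mutualInfo_lt_iff {c : ℝ} (hc : 0 ≤ c) {p q : ℕ} (H : Matrix (Fin p) (Fin q) ℂ) (R : ℝ) :
    mutualInfo c H < R ↔ channelDet c H < Real.exp R :=
  Real.log_lt_iff_lt_exp (one_pos.trans_le (one_le_channelDet hc H))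

/-- Zero forcing reduces the outage event to that of a Gaussian channel with `Nt - Ne` transmit
antennas. -/
theorem zfOutageProb_le_gaussianMat [IsProbabilityMeasure μ] (hN : Ne < Nt)
    (h : IsIIDGaussianChannel μ Hm He) {A : Ω → Matrix (Fin Nt) (Fin (Nt - Ne)) ℂ}
    (hA : ∀ᵐ ω ∂μ, IsZFPrecoder (He ω) (A ω)) {η : ℝ} (hη : 0 ≤ η) (Rs : ℝ) :
    zfOutageProb μ Ne Hm A η Rs ≤ (gaussianMat Nm (Nt - Ne)).real
      {x | channelDet (η / ((Nt : ℝ) - (Ne : ℝ))) (Matrix.of x) < Real.exp Rs} := by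
  set c := η / ((Nt : ℝ) - (Ne : ℝ)) with hcdef
  have hc : 0 ≤ c := div_nonneg hη (sub_nonneg.2 (by exact_mod_cast hN.le))
  set T := {p : (Fin Nm → Fin Nt → ℂ) × (Fin Ne → Fin Nt → ℂ) |
    (Matrix.det (1 + (c : ℂ) • (Matrix.of p.1 * kerProj (Matrix.of p.2) *
        (Matrix.of p.1)ᴴ))).re < Real.exp Rs}
  have hT : MeasurableSet T :=
    measurableSet_lt (measurable_det_kerProj c Nm Ne Nt) measurable_const
  -- `A` need not be measurable, so its event is first covered, up to a null set, by an event in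
  -- `Hm` and `He` alone.
  have h1 : μ {ω | mutualInfo c (Hm ω * A ω) < Rs} ≤
      μ {ω | ((fun i j => Hm ω i j, fun i j => He ω i j) :
        (Fin Nm → Fin Nt → ℂ) × (Fin Ne → Fin Nt → ℂ)) ∈ T} := by
    refine measure_mono_ae ?_
    filter_upwards [hA] with ω hω hlt
    have h2 := (mutualInfo_lt_iff hc _ _).1 hlt
    rw [channelDet, Matrix.conjTranspose_mul, ← Matrix.mul_assoc, Matrix.mul_assoc (Hm ω),
      hω.mul_conjTranspose_eq hN] at h2
    exact h2
  have h3 := h.hasLaw.measure_eq (p := fun p => p ∈ T) hT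
  rw [h3] at h1
  refine ENNReal.toReal_mono (measure_ne_top _ _) (h1.trans ?_)
  change ((gaussianMat Nm Nt).prod (gaussianMat Ne Nt)) T ≤ _
  rw [Measure.prod_apply_symm hT]
  refine (lintegral_mono (g := fun _ => gaussianMat Nm (Nt - Ne)
    {x | channelDet c (Matrix.of x) < Real.exp Rs}) fun y => ?_).trans (by simp)
  obtain ⟨U, hU, hyU⟩ := exists_isometry_mul_eq_zero (n := Nt - Ne) (by omega)
    (Matrix.of y : Matrix (Fin Ne) (Fin Nt) ℂ)
  change _ ≤ gaussianMat Nm (Nt - Ne) _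
  rw [← gaussianMat_map_mul hU, Measure.map_apply (measurable_vecMul_rows U)
    (measurableSet_lt (measurable_channelDet c _ _) measurable_const)]
  refine measure_mono fun x hx => lt_of_le_of_lt ?_ (show _ < Real.exp Rs from hx)
  exact channelDet_mul_le hc (Matrix.of x) U (kerProj_sub_posSemidef hU hyU)

theorem gaussianMat_channelDet_lt_swap (c : ℝ) (m k : ℕ) (E : ℝ) :
    gaussianMat m k {x | channelDet c (Matrix.of x) < E} =
      gaussianMat k m {x | channelDet c (Matrix.of x) < E} := by
  rw [← gaussianMat_map_swap m k, Measure.map_apply (by fun_prop)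
    (measurableSet_lt (measurable_channelDet c _ _) measurable_const)]
  congr 1
  ext x
  exact iff_of_eq (congrArg (· < E) (channelDet_transpose c (Matrix.of x)).symm)

theorem gaussianMat_channelDet_lt_min_max (c : ℝ) (m k : ℕ) (E : ℝ) :
    gaussianMat m k {x | channelDet c (Matrix.of x) < E} =
      gaussianMat (min k m) (max k m) {x | channelDet c (Matrix.of x) < E} := by
  rcases le_total m k with h | h
  · rw [min_eq_right h, max_eq_left h]
  · rw [min_eq_left h, max_eq_right h, gaussianMat_channelDet_lt_swap]

theorem prod_Icc_one_eq_prod_range (m : ℕ) (f : ℕ → ℝ) :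
    ∏ l ∈ Finset.Icc 1 m, f l = ∏ l ∈ Finset.range m, f (l + 1) := by
  induction m with
  | zero => simp
  | succ m ih => rw [Finset.prod_Icc_succ_top (by omega), ih, Finset.prod_range_succ]

theorem zfXi_nonneg {Nt Ne : ℕ} (hN : Ne < Nt) {η g x : ℝ} (hη : 0 < η) (hg : 0 ≤ g)
    (hx : 0 ≤ x) : 0 ≤ zfXi Nt Ne η g x := by
  have h1 : (0 : ℝ) < (Nt : ℝ) - Ne := sub_pos.2 (by exact_mod_cast hN)
  have h2 : 1 ≤ (1 + g * η) ^ x := Real.one_le_rpow (by nlinarith [mul_nonneg hg hη.le]) hx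
  exact mul_nonneg (by positivity) (sub_nonneg.2 h2)

theorem zfXi_mono {Nt Ne : ℕ} (hN : Ne < Nt) {η g x y : ℝ} (hη : 0 < η) (hg : 0 ≤ g)
    (hxy : x ≤ y) : zfXi Nt Ne η g x ≤ zfXi Nt Ne η g y := by
  have h1 : (0 : ℝ) < (Nt : ℝ) - Ne := sub_pos.2 (by exact_mod_cast hN)
  have h2 : 1 ≤ 1 + g * η := by nlinarith [mul_nonneg hg hη.le]
  unfold zfXi
  gcongr

/-- The purpose of `ξ`: adding exponents multiplies the factors `1 + c ξ`. -/
theorem one_add_mul_zfXi {Nt Ne : ℕ} (hN : Ne < Nt) {η : ℝ} (hη : 0 < η) (g x : ℝ) :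
    1 + η / ((Nt : ℝ) - (Ne : ℝ)) * zfXi Nt Ne η g x = (1 + g * η) ^ x := by
  have h1 : (0 : ℝ) < (Nt : ℝ) - Ne := sub_pos.2 (by exact_mod_cast hN)
  unfold zfXi
  field_simp
  ring

theorem exp_secrecyRate {g η : ℝ} (hη : 0 < η) (hg : 0 ≤ g) (rs : ℝ) :
    Real.exp (secrecyRate g η rs) = (1 + g * η) ^ rs := by
  rw [secrecyRate, mul_comm, Real.rpow_def_of_pos (by positivity)]

end ChannelLaw

/-! ### The outage bound -/

theorem theorem1 {Ω : Type*} [MeasurableSpace Ω] (μ : Measure Ω) [IsProbabilityMeasure μ]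
    (Nt Nm Ne : ℕ) (hN : Ne < Nt)
    (Hm : Ω → Matrix (Fin Nm) (Fin Nt) ℂ) (He : Ω → Matrix (Fin Ne) (Fin Nt) ℂ)
    (hH : IsIIDGaussianChannel μ Hm He)
    (A : Ω → Matrix (Fin Nt) (Fin (Nt - Ne)) ℂ)
    (hA : ∀ᵐ ω ∂μ, IsZFPrecoder (He ω) (A ω))
    (η g : ℝ) (hη : 0 < η) (hg : 0 ≤ g)
    (m k : ℕ) (hm : m = min (Nt - Ne) Nm) (hk : k = max (Nt - Ne) Nm)
    (rs : ℝ) (b : ℕ → ℝ)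
    (hb_nonneg : ∀ l ∈ Finset.Icc 1 m, 0 ≤ b l)
    (hb_anti : AntitoneOn b (Set.Icc 1 m))
    (hb_sum : rs = ∑ l ∈ Finset.Icc 1 m, b l) :
    zfOutageProb μ Ne Hm A η (secrecyRate g η rs) ≤
      (∏ l ∈ Finset.Icc 1 m, gammaInc (zfXi Nt Ne η g rs) (k - l + 1)) *
        (1 - ∏ l ∈ Finset.Icc 1 m,
          (1 - gammaInc (zfXi Nt Ne η g (b l)) (k - l + 1) /
            gammaInc (zfXi Nt Ne η g rs) (k - l + 1))) := by
  set c := η / ((Nt : ℝ) - (Ne : ℝ)) with hcdef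
  have hc : 0 < c := div_pos hη (sub_pos.2 (by exact_mod_cast hN))
  have hrs : 0 ≤ rs := hb_sum ▸ Finset.sum_nonneg hb_nonneg
  have hmk : m ≤ k := by rw [hm, hk]; exact min_le_max
  have hs : 0 ≤ zfXi Nt Ne η g rs := zfXi_nonneg hN hη hg hrs
  have hE : (1 + g * η) ^ rs = 1 + c * zfXi Nt Ne η g rs := (one_add_mul_zfXi hN hη g rs).symm
  have hle := zfOutageProb_le_gaussianMat hN hH hA hη.le (secrecyRate g η rs)
  rw [Measure.real, gaussianMat_channelDet_lt_min_max, ← hm, ← hk, exp_secrecyRate hη hg] at hle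
  refine hle.trans ?_
  -- If `ξ(r_s) = 0` the threshold is `1` and outage is impossible. The right-hand side vanishes
  -- too: by its first product if `m > 0`, and by `1 - 1` if `m = 0`.
  rcases hs.eq_or_lt with h0 | hs'
  · rw [gaussianMat_channelDet_lt_of_le_one hc.le _ _ (by rw [hE, ← h0]; simp), ← h0]
    rcases Nat.eq_zero_or_pos m with rfl | hm0
    · simp
    · rw [Finset.prod_eq_zero (Finset.mem_Icc.2 ⟨le_rfl, hm0⟩) (by simp [gammaInc])]
      simp
  have hmem : ∀ l < m, l + 1 ∈ Finset.Icc 1 m := fun l hl => Finset.mem_Icc.2 ⟨by omega, by omega⟩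
  have hbrs : ∀ l < m, b (l + 1) ≤ rs := fun l hl =>
    hb_sum ▸ Finset.single_le_sum hb_nonneg (hmem l hl)
  have hpos : 0 < 1 + g * η := by positivity
  have hbound := gaussianMat_channelDet_lt_le hc hs hmk
    (t := fun l => zfXi Nt Ne η g (b (l + 1)))
    (fun l hl => zfXi_nonneg hN hη hg (hb_nonneg _ (hmem l hl)))
    (fun l hl => zfXi_mono hN hη hg (hbrs l hl)) hE.le (by
      refine le_of_eq ?_
      rw [Finset.prod_congr rfl fun l _ => one_add_mul_zfXi hN hη g (b (l + 1)),
        ← prod_Icc_one_eq_prod_range m fun l => (1 + g * η) ^ b l,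
        ← Real.rpow_sum_of_pos hpos, ← hb_sum])
  have ht : ∀ l < m, gammaInc (zfXi Nt Ne η g (b (l + 1))) (k - l) ≤
      gammaInc (zfXi Nt Ne η g rs) (k - l) := fun l hl =>
    gammaInc_mono (zfXi_nonneg hN hη hg (hb_nonneg _ (hmem l hl)))
      (zfXi_mono hN hη hg (hbrs l hl)) _
  have h0 : ∀ l < m, 0 ≤ gammaInc (zfXi Nt Ne η g (b (l + 1))) (k - l) := fun l hl =>
    gammaInc_nonneg (zfXi_nonneg hN hη hg (hb_nonneg _ (hmem l hl))) _
  refine (ENNReal.toReal_mono ENNReal.ofReal_ne_top hbound).trans ?_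
  rw [ENNReal.toReal_ofReal (sub_nonneg.2 (Finset.prod_le_prod
    (fun l hl => sub_nonneg.2 (ht l (Finset.mem_range.1 hl)))
    (fun l hl => sub_le_self _ (h0 l (Finset.mem_range.1 hl)))))]
  refine le_of_eq ?_
  rw [mul_sub, mul_one, ← Finset.prod_mul_distrib, prod_Icc_one_eq_prod_range,
    prod_Icc_one_eq_prod_range]
  -- Truncated subtraction is harmless here because `l < m ≤ k`.
  have hkl : ∀ l ∈ Finset.range m, k - (l + 1) + 1 = k - l := fun l hl => by
    have := Finset.mem_range.1 hl
    omega
  refine congrArg₂ (· - ·) (Finset.prod_congr rfl fun l hl => by rw [hkl l hl])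
    (Finset.prod_congr rfl fun l hl => ?_)
  rw [hkl l hl, mul_sub, mul_one, mul_div_cancel₀ _ (gammaInc_pos hs' _).ne']
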